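/- All Banach lattices are real. For a Banach lattice $E$, the topological dual $E^*$ carries its usual norm and order ($\varphi\le\psi$ iff $\varphi(x)\le\psi(x)$ for all $x\ge 0$), so that $E^*$ and $E^{**}$ are again Banach lattices. A functional $\varphi\in E^*$ is a Riesz homomorphism if $\varphi(x\vee y)=\max\{\varphi(x),\varphi(y)\}$ for all $x,y\in E$. A Riesz multimorphism $A\colon E_1\times\cdots\times E_m\to F$ is a regular $m$-linear operator (a difference of two positive $m$-linear operators) with $|A(x_1,\dots,x_m)|=A(|x_1|,\dots,|x_m|)$ for all $x_i\in E_i$. For a continuous $m$-linear operator $A\colon E_1\times\cdots\times E_m\to F$ and a permutation $\rho$ of $\{1,\dots,m\}$, the Aron–Berner extension $AB_m^\rho(A)\colon E_1^{**}\times\cdots\times E_m^{**}\to F^{**}$ is defined as follows: for $x_i^{**}\in E_i^{**}$ and $y^*\in F^*$, the number $AB_m^\rho(A)(x_1^{**},\dots,x_m^{**})(y^*)$ is obtained from the $m$-linear form $y^*\circ A$ by applying successively $x_{\rho(1)}^{**},x_{\rho(2)}^{**},\dots,x_{\rho(m)}^{**}$ to the variables numbered $\rho(1),\rho(2),\dots,\rho(m)$;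 here, applying $x_j^{**}$ to the $j$-th variable of a continuous multilinear form $B$ means passing to the form, in the remaining variables, whose value is $x_j^{**}$ evaluated at the functional $t\mapsto B(\dots,t,\dots)$ in $E_j^*$ ($t$ in the $j$-th place). **Corollary.** Let $F$ be a Banach lattice such that $F^*$ has a Schauder basis (infinite, or finite if $F$ is finite-dimensional) consisting of Riesz homomorphisms. Then for every natural number $m$, all Banach lattices $E_1,\dots,E_m$ and every Riesz multimorphism $A\colon E_1\times\cdots\times E_m\to F$, the operator $A$ is continuous and, for every permutation $\rho$ of $\{1,\dots,m\}$, the Aron–Berner extension $AB_m^\rho(A)\colon E_1^{**}\times\cdots\times E_m^{**}\to F^{**}$ is a Riesz multimorphism. -/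

import Mathlib

universe u v

/-- A real Banach lattice: a complete normed space that is a vector lattice (Riesz space) whose
norm is solid, i.e. `|x| ≤ |y|` implies `‖x‖ ≤ ‖y‖`. -/
class IsBanachLattice (E : Type*) [NormedAddCommGroup E] [NormedSpace ℝ E] [Lattice E] : Prop
    extends IsOrderedAddMonoid E, IsOrderedModule ℝ E, HasSolidNorm E, CompleteSpace E

/-! ### The dual of a Banach lattice, with its usual order `φ ≤ ψ ↔ ∀ x ≥ 0, φ x ≤ ψ x` -/

namespace DualLattice

variable {E : Type*} [NormedAddCommGroup E] [NormedSpace ℝ E] [Lattice E] [IsBanachLattice E]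

theorem le_norm_mul (φ : StrongDual ℝ E) {x z : E} (hz0 : 0 ≤ z) (hz : z ≤ x) :
    φ z ≤ ‖φ‖ * ‖x‖ := by
  have h1 : φ z ≤ ‖φ‖ * ‖z‖ := (le_abs_self _).trans (φ.le_opNorm z)
  have h2 : ‖z‖ ≤ ‖x‖ := by
    apply HasSolidNorm.solid
    rw [abs_of_nonneg hz0, abs_of_nonneg (hz0.trans hz)]
    exact hz
  exact h1.trans (mul_le_mul_of_nonneg_left h2 (norm_nonneg _))

/-- `sup {φ z : 0 ≤ z ≤ x}`, the value of the positive part of `φ` at `x ≥ 0`. -/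
noncomputable def posVal (φ : StrongDual ℝ E) (x : E) : ℝ := sSup (φ '' Set.Icc 0 x)

theorem bddAbove (φ : StrongDual ℝ E) (x : E) : BddAbove (φ '' Set.Icc 0 x) := by
  refine ⟨‖φ‖ * ‖x‖, ?_⟩
  rintro _ ⟨z, hz, rfl⟩
  exact le_norm_mul φ hz.1 hz.2

theorem le_posVal (φ : StrongDual ℝ E) {x z : E} (h0 : 0 ≤ z) (hz : z ≤ x) :
    φ z ≤ posVal φ x :=
  le_csSup (bddAbove φ x) ⟨z, ⟨h0, hz⟩, rfl⟩

theorem posVal_le {E : Type*} [NormedAddCommGroup E] [NormedSpace ℝ E] [Lattice E]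
    (φ : StrongDual ℝ E) {x : E} (hx : 0 ≤ x) {c : ℝ}
    (h : ∀ z, 0 ≤ z → z ≤ x → φ z ≤ c) : posVal φ x ≤ c := by
  refine csSup_le ⟨φ 0, 0, ⟨le_rfl, hx⟩, rfl⟩ ?_
  rintro _ ⟨z, hz, rfl⟩
  exact h z hz.1 hz.2

theorem posVal_nonneg (φ : StrongDual ℝ E) {x : E} (hx : 0 ≤ x) : 0 ≤ posVal φ x := by
  simpa using le_posVal φ le_rfl hx

theorem posVal_add (φ : StrongDual ℝ E) {x y : E} (hx : 0 ≤ x) (hy : 0 ≤ y) :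
    posVal φ (x + y) = posVal φ x + posVal φ y := by
  apply le_antisymm
  · refine posVal_le φ (add_nonneg hx hy) fun z h0 hz => ?_
    have h1 : φ (z ⊓ x) ≤ posVal φ x := le_posVal φ (le_inf h0 hx) inf_le_right
    have h2 : φ (z - z ⊓ x) ≤ posVal φ y := by
      refine le_posVal φ (sub_nonneg.2 inf_le_left) ?_
      rw [sub_le_iff_le_add, add_inf]
      exact le_inf (by simpa using hy) (by rwa [add_comm])
    have h3 : φ z = φ (z ⊓ x) + φ (z - z ⊓ x) := by rw [← map_add]; congr 1; abel
    linarith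
  · have key : ∀ w, 0 ≤ w → w ≤ y → posVal φ x ≤ posVal φ (x + y) - φ w := fun w h0 hw =>
      posVal_le φ hx fun z hz0 hz => by
        have := le_posVal φ (add_nonneg hz0 h0) (add_le_add hz hw)
        rw [map_add] at this
        linarith
    have : posVal φ y ≤ posVal φ (x + y) - posVal φ x :=
      posVal_le φ hy fun w h0 hw => by linarith [key w h0 hw]
    linarith

theorem posVal_sub_eq (φ : StrongDual ℝ E) {a b c d : E} (ha : 0 ≤ a) (hb : 0 ≤ b) (hc : 0 ≤ c)
    (hd : 0 ≤ d) (h : a - b = c - d) : posVal φ a - posVal φ b = posVal φ c - posVal φ d := by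
  have h1 : a + d = c + b := by rwa [sub_eq_sub_iff_add_eq_add] at h
  have h2 := posVal_add φ ha hd
  rw [h1, posVal_add φ hc hb] at h2
  linarith

/-- The positive part `φ⁺` of a continuous functional (Riesz-Kantorovich formula):
`φ⁺ x = sup {φ z : 0 ≤ z ≤ x}` for `x ≥ 0`, extended additively. -/
noncomputable def posPart (φ : StrongDual ℝ E) : StrongDual ℝ E :=
  AddMonoidHom.toRealLinearMap
    { toFun := fun x => posVal φ x⁺ - posVal φ x⁻
      map_zero' := by simp
      map_add' := fun x y => by
        have := posVal_sub_eq φ (posPart_nonneg (x + y)) (negPart_nonneg (x + y))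
          (add_nonneg (posPart_nonneg x) (posPart_nonneg y))
          (add_nonneg (negPart_nonneg x) (negPart_nonneg y))
          (by rw [add_sub_add_comm, posPart_sub_negPart, posPart_sub_negPart,
            posPart_sub_negPart])
        rw [this, posVal_add φ (posPart_nonneg x) (posPart_nonneg y),
          posVal_add φ (negPart_nonneg x) (negPart_nonneg y)]
        ring }
    (by
      refine AddMonoidHomClass.continuous_of_bound _ ‖φ‖ fun x => ?_
      have hb : ∀ y : E, 0 ≤ y → y ≤ |x| → posVal φ y ≤ ‖φ‖ * ‖x‖ := fun y h0 hy =>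
        posVal_le φ h0 fun z hz0 hz => by
          have := le_norm_mul φ hz0 (hz.trans hy)
          rwa [norm_abs_eq_norm] at this
      have h1 := hb x⁺ (posPart_nonneg x) (by
        rw [← posPart_add_negPart]; simp)
      have h2 := hb x⁻ (negPart_nonneg x) (by
        rw [← posPart_add_negPart]; simp)
      have h3 := posVal_nonneg φ (posPart_nonneg x)
      have h4 := posVal_nonneg φ (negPart_nonneg x)
      change |posVal φ x⁺ - posVal φ x⁻| ≤ _
      rw [abs_le]
      constructor <;> linarith)

theorem posPart_apply (φ : StrongDual ℝ E) {x : E} (hx : 0 ≤ x) :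
    posPart φ x = sSup (φ '' Set.Icc 0 x) := by
  change posVal φ x⁺ - posVal φ x⁻ = posVal φ x
  rw [posPart_of_nonneg hx, negPart_of_nonneg hx]
  simp [posVal]

/-- The dual order. -/
instance instPartialOrder : PartialOrder (StrongDual ℝ E) where
  le φ ψ := ∀ x : E, 0 ≤ x → φ x ≤ ψ x
  le_refl _ _ _ := le_rfl
  le_trans _ _ _ h1 h2 x hx := (h1 x hx).trans (h2 x hx)
  le_antisymm φ ψ h1 h2 := by
    ext x
    have e : ∀ y : E, 0 ≤ y → φ y = ψ y := fun y hy => le_antisymm (h1 y hy) (h2 y hy)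
    rw [← posPart_sub_negPart x, map_sub, map_sub, e _ (posPart_nonneg x),
      e _ (negPart_nonneg x)]

theorem le_iff {φ ψ : StrongDual ℝ E} : φ ≤ ψ ↔ ∀ x : E, 0 ≤ x → φ x ≤ ψ x := Iff.rfl

theorem le_posPart (φ : StrongDual ℝ E) : φ ≤ posPart φ := fun x hx => by
  rw [posPart_apply φ hx]
  exact le_posVal φ hx le_rfl

theorem zero_le_posPart (φ : StrongDual ℝ E) : 0 ≤ posPart φ := fun x hx => by
  rw [posPart_apply φ hx]
  exact posVal_nonneg φ hx

theorem posPart_le {φ ψ : StrongDual ℝ E} (h : φ ≤ ψ) (h0 : 0 ≤ ψ) : posPart φ ≤ ψ :=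
  fun x hx => by
    rw [posPart_apply φ hx]
    refine posVal_le φ hx fun z hz0 hz => (h z hz0).trans ?_
    have := h0 (x - z) (sub_nonneg.2 hz)
    rw [map_sub] at this
    simpa using this

instance instIsOrderedAddMonoid : IsOrderedAddMonoid (StrongDual ℝ E) where
  add_le_add_left φ ψ h χ x hx := by simpa using h x hx

/-- The dual of a Banach lattice is a lattice, with `φ ⊔ ψ = ψ + (φ - ψ)⁺` and
`φ ⊓ ψ = φ - (φ - ψ)⁺`. -/
noncomputable instance instLattice : Lattice (StrongDual ℝ E) where
  sup φ ψ := ψ + posPart (φ - ψ)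
  le_sup_left φ ψ := by
    have := add_le_add_right (le_posPart (φ - ψ)) ψ
    simpa using this
  le_sup_right φ ψ := le_add_of_nonneg_right (zero_le_posPart _)
  sup_le φ ψ χ h1 h2 := by
    rw [← le_sub_iff_add_le']
    exact posPart_le (sub_le_sub_right h1 _) (sub_nonneg.2 h2)
  inf φ ψ := φ - posPart (φ - ψ)
  inf_le_left φ ψ := sub_le_self _ (zero_le_posPart _)
  inf_le_right φ ψ := by
    rw [sub_le_comm]
    exact le_posPart _
  le_inf φ ψ χ h1 h2 := by
    rw [le_sub_comm]
    exact posPart_le (sub_le_sub_left h2 _) (sub_nonneg.2 h1)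

theorem sup_eq (φ ψ : StrongDual ℝ E) : φ ⊔ ψ = ψ + posPart (φ - ψ) := rfl

theorem abs_apply_le (φ : StrongDual ℝ E) (x : E) : |φ x| ≤ |φ| |x| := by
  have h1 : φ ≤ |φ| := le_abs_self φ
  have h2 : -φ ≤ |φ| := neg_le_abs φ
  have e1 : φ x = φ x⁺ - φ x⁻ := by rw [← map_sub, posPart_sub_negPart]
  have e2 : |φ| |x| = |φ| x⁺ + |φ| x⁻ := by rw [← map_add, posPart_add_negPart]
  have a1 := h1 _ (posPart_nonneg x)
  have a2 := h1 _ (negPart_nonneg x)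
  have b1 := h2 _ (posPart_nonneg x)
  have b2 := h2 _ (negPart_nonneg x)
  simp only [neg_apply] at b1 b2
  rw [abs_le, e1, e2]
  constructor <;> linarith

theorem abs_apply_le_norm (φ : StrongDual ℝ E) {x : E} (hx : 0 ≤ x) : |φ| x ≤ ‖φ‖ * ‖x‖ := by
  have e : |φ| = -φ + posPart (φ - -φ) := rfl
  rw [e, add_apply, posPart_apply _ hx]
  have : posVal (φ - -φ) x ≤ φ x + ‖φ‖ * ‖x‖ := posVal_le _ hx fun z h0 hz => by
    have h1 : (φ - -φ) z = φ x + φ (z - (x - z)) := by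
      simp only [sub_apply, neg_apply, map_sub]; ring
    have h2 : ‖z - (x - z)‖ ≤ ‖x‖ := by
      apply HasSolidNorm.solid
      rw [abs_of_nonneg hx]
      refine abs_le'.2 ⟨?_, ?_⟩
      · exact (sub_le_self _ (sub_nonneg.2 hz)).trans hz
      · rw [neg_sub]
        exact (sub_le_self _ h0).trans (sub_le_self _ h0)
    have h3 := (le_abs_self _).trans (φ.le_opNorm (z - (x - z)))
    have h4 := mul_le_mul_of_nonneg_left h2 (norm_nonneg φ)
    linarith
  simp only [neg_apply]
  change -φ x + posVal (φ - -φ) x ≤ _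
  linarith

/-- The dual of a Banach lattice is a Banach lattice. -/
instance instIsBanachLattice : IsBanachLattice (StrongDual ℝ E) where
  smul_le_smul_of_nonneg_left c hc φ ψ h x hx := by
    simpa using mul_le_mul_of_nonneg_left (h x hx) hc
  smul_le_smul_of_nonneg_right φ hφ c d h x hx := by
    have := hφ x hx
    simpa using mul_le_mul_of_nonneg_right h (by simpa using this)
  solid φ ψ h := by
    refine φ.opNorm_le_bound (norm_nonneg ψ) fun x => ?_
    calc |φ x| ≤ |φ| |x| := abs_apply_le φ x
      _ ≤ |ψ| |x| := h _ (abs_nonneg x)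
      _ ≤ ‖ψ‖ * ‖|x|‖ := abs_apply_le_norm ψ (abs_nonneg x)
      _ = ‖ψ‖ * ‖x‖ := by rw [norm_abs_eq_norm]

end DualLattice

/-! ### Riesz homomorphisms and Riesz multimorphisms -/

/-- A functional on a vector lattice is a Riesz homomorphism if it preserves the lattice
operations. (Preserving `⊔` is enough, since `x ⊓ y = -(-x ⊔ -y)`.) -/
def IsRieszHom {E : Type*} [NormedAddCommGroup E] [NormedSpace ℝ E] [Lattice E]
    (φ : StrongDual ℝ E) : Prop :=
  ∀ x y : E, φ (x ⊔ y) = φ x ⊔ φ y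

section Multi

variable {ι : Type*} {E : ι → Type*} {F : Type*}
  [∀ i, AddCommGroup (E i)] [∀ i, Module ℝ (E i)] [∀ i, Lattice (E i)]
  [AddCommGroup F] [Module ℝ F] [Lattice F]

/-- A multilinear operator is positive if it is nonnegative on tuples of nonnegative vectors. -/
def IsPositiveMultilinear (A : MultilinearMap ℝ E F) : Prop :=
  ∀ x : ∀ i, E i, (∀ i, 0 ≤ x i) → 0 ≤ A x

/-- A multilinear operator is regular if it is a difference of two positive ones. -/
def IsRegularMultilinear (A : MultilinearMap ℝ E F) : Prop :=
  ∃ P Q : MultilinearMap ℝ E F, IsPositiveMultilinear P ∧ IsPositiveMultilinear Q ∧ A = P - Q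

/-- A Riesz multimorphism: a regular multilinear operator `A` such that
`|A (x₁, …, xₘ)| = A (|x₁|, …, |xₘ|)`. -/
structure IsRieszMultimorphism (A : MultilinearMap ℝ E F) : Prop where
  regular : IsRegularMultilinear A
  abs_map : ∀ x : ∀ i, E i, |A x| = A fun i => |x i|

end Multi

/-! ### Aron-Berner extensions -/

namespace AronBerner

/-- The functional `B (•, x₂, …, xₘ)` on `E₁` associated to a continuous `m`-linear form `B`. -/
noncomputable def section₁ {m : ℕ} {E : Fin (m + 1) → Type*} [∀ i, NormedAddCommGroup (E i)]
    [∀ i, NormedSpace ℝ (E i)] (B : ContinuousMultilinearMap ℝ E ℝ) :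
    ContinuousMultilinearMap ℝ (fun i : Fin m => E i.succ) (StrongDual ℝ (E 0)) :=
  B.curryLeft.flipMultilinear

theorem section₁_apply {m : ℕ} {E : Fin (m + 1) → Type*} [∀ i, NormedAddCommGroup (E i)]
    [∀ i, NormedSpace ℝ (E i)] (B : ContinuousMultilinearMap ℝ E ℝ)
    (x : ∀ i : Fin m, E i.succ) (t : E 0) : section₁ B x t = B (Fin.cons t x) := rfl

/-- For `Φ` in the bidual of `E₁`, the `(m-1)`-linear form
`(x₂, …, xₘ) ↦ Φ (B (•, x₂, …, xₘ))`. -/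
noncomputable def contract {m : ℕ} {E : Fin (m + 1) → Type*} [∀ i, NormedAddCommGroup (E i)]
    [∀ i, NormedSpace ℝ (E i)] (Φ : StrongDual ℝ (StrongDual ℝ (E 0)))
    (B : ContinuousMultilinearMap ℝ E ℝ) :
    ContinuousMultilinearMap ℝ (fun i : Fin m => E i.succ) ℝ :=
  Φ.compContinuousMultilinearMap (section₁ B)

theorem contract_apply {m : ℕ} {E : Fin (m + 1) → Type*} [∀ i, NormedAddCommGroup (E i)]
    [∀ i, NormedSpace ℝ (E i)] (Φ : StrongDual ℝ (StrongDual ℝ (E 0)))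
    (B : ContinuousMultilinearMap ℝ E ℝ) (x : ∀ i : Fin m, E i.succ) :
    contract Φ B x = Φ (section₁ B x) := rfl

/-- Apply `x''₁, …, x''ₘ` successively, in this order, to the variables `1, …, m` of `B`; what
remains after the last step is a number. -/
noncomputable def extendForm : {m : ℕ} → {E : Fin m → Type u} →
    [∀ i, NormedAddCommGroup (E i)] → [∀ i, NormedSpace ℝ (E i)] →
    ContinuousMultilinearMap ℝ E ℝ → (∀ i, StrongDual ℝ (StrongDual ℝ (E i))) → ℝ
  | 0, _, _, _, B, _ => B 0
  | _ + 1, _, _, _, B, x => extendForm (contract (x 0) B) fun i => x i.succ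

theorem extendForm_zero {E : Fin 0 → Type u} [∀ i, NormedAddCommGroup (E i)]
    [∀ i, NormedSpace ℝ (E i)] (B : ContinuousMultilinearMap ℝ E ℝ)
    (x : ∀ i, StrongDual ℝ (StrongDual ℝ (E i))) : extendForm B x = B 0 := rfl

theorem extendForm_succ {m : ℕ} {E : Fin (m + 1) → Type u} [∀ i, NormedAddCommGroup (E i)]
    [∀ i, NormedSpace ℝ (E i)] (B : ContinuousMultilinearMap ℝ E ℝ)
    (x : ∀ i, StrongDual ℝ (StrongDual ℝ (E i))) :
    extendForm B x = extendForm (contract (x 0) B) fun i => x i.succ := rfl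

theorem extendForm_add {m : ℕ} : ∀ {E : Fin m → Type u} [∀ i, NormedAddCommGroup (E i)]
    [∀ i, NormedSpace ℝ (E i)] (B C : ContinuousMultilinearMap ℝ E ℝ)
    (x : ∀ i, StrongDual ℝ (StrongDual ℝ (E i))),
    extendForm (B + C) x = extendForm B x + extendForm C x := by
  induction m with
  | zero => intro E _ _ B C x; rfl
  | succ m ih =>
    intro E _ _ B C x
    have h : contract (x 0) (B + C) = contract (x 0) B + contract (x 0) C := by
      ext v
      have : section₁ (B + C) v = section₁ B v + section₁ C v := rfl
      simp [contract_apply, this]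
    rw [extendForm_succ, h, ih, ← extendForm_succ, ← extendForm_succ]

theorem extendForm_smul {m : ℕ} : ∀ {E : Fin m → Type u} [∀ i, NormedAddCommGroup (E i)]
    [∀ i, NormedSpace ℝ (E i)] (c : ℝ) (B : ContinuousMultilinearMap ℝ E ℝ)
    (x : ∀ i, StrongDual ℝ (StrongDual ℝ (E i))),
    extendForm (c • B) x = c * extendForm B x := by
  induction m with
  | zero => intro E _ _ c B x; rfl
  | succ m ih =>
    intro E _ _ c B x
    have h : contract (x 0) (c • B) = c • contract (x 0) B := by
      ext v
      have : section₁ (c • B) v = c • section₁ B v := rfl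
      simp [contract_apply, this]
    rw [extendForm_succ, h, ih, ← extendForm_succ]

theorem norm_section₁_le {m : ℕ} {E : Fin (m + 1) → Type u} [∀ i, NormedAddCommGroup (E i)]
    [∀ i, NormedSpace ℝ (E i)] (B : ContinuousMultilinearMap ℝ E ℝ)
    (v : ∀ i : Fin m, E i.succ) : ‖section₁ B v‖ ≤ ‖B‖ * ∏ i, ‖v i‖ := by
  refine ContinuousLinearMap.opNorm_le_bound _ (by positivity) fun t => ?_
  rw [section₁_apply]
  refine (B.le_opNorm _).trans (le_of_eq ?_)
  rw [Fin.prod_univ_succ]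
  simp only [Fin.cons_zero, Fin.cons_succ]
  ring

theorem norm_contract_le {m : ℕ} {E : Fin (m + 1) → Type u} [∀ i, NormedAddCommGroup (E i)]
    [∀ i, NormedSpace ℝ (E i)] (Φ : StrongDual ℝ (StrongDual ℝ (E 0)))
    (B : ContinuousMultilinearMap ℝ E ℝ) : ‖contract Φ B‖ ≤ ‖Φ‖ * ‖B‖ := by
  refine ContinuousMultilinearMap.opNorm_le_bound (by positivity) fun v => ?_
  rw [contract_apply, mul_assoc]
  exact (Φ.le_opNorm _).trans (mul_le_mul_of_nonneg_left (norm_section₁_le B v) (norm_nonneg _))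

theorem norm_extendForm_le {m : ℕ} : ∀ {E : Fin m → Type u} [∀ i, NormedAddCommGroup (E i)]
    [∀ i, NormedSpace ℝ (E i)] (B : ContinuousMultilinearMap ℝ E ℝ)
    (x : ∀ i, StrongDual ℝ (StrongDual ℝ (E i))),
    ‖extendForm B x‖ ≤ (∏ i, ‖x i‖) * ‖B‖ := by
  induction m with
  | zero => intro E _ _ B x; simpa [extendForm_zero] using B.le_opNorm 0
  | succ m ih =>
    intro E _ _ B x
    rw [extendForm_succ, Fin.prod_univ_succ]
    calc _ ≤ _ := ih _ _
      _ ≤ (∏ i : Fin m, ‖x i.succ‖) * (‖x 0‖ * ‖B‖) :=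
        mul_le_mul_of_nonneg_left (norm_contract_le _ _) (by positivity)
      _ = _ := by ring

theorem extendForm_update_add {m : ℕ} : ∀ {E : Fin m → Type u} [∀ i, NormedAddCommGroup (E i)]
    [∀ i, NormedSpace ℝ (E i)] (B : ContinuousMultilinearMap ℝ E ℝ)
    (x : ∀ i, StrongDual ℝ (StrongDual ℝ (E i))) (i : Fin m)
    (Φ Ψ : StrongDual ℝ (StrongDual ℝ (E i))),
    extendForm B (Function.update x i (Φ + Ψ)) =
      extendForm B (Function.update x i Φ) + extendForm B (Function.update x i Ψ) := by
  induction m with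
  | zero => intro E _ _ B x i; exact i.elim0
  | succ m ih =>
    intro E _ _ B x i
    refine Fin.cases ?_ (fun j => ?_) i <;> intro Φ Ψ <;> simp only [extendForm_succ]
    · have h : contract (Φ + Ψ) B = contract Φ B + contract Ψ B := by
        ext v; simp [contract_apply]
      have t : ∀ Θ : StrongDual ℝ (StrongDual ℝ (E 0)),
          (fun i : Fin m => Function.update x 0 Θ i.succ) = fun i : Fin m => x i.succ := fun Θ => by
        funext i; simp [Function.update_of_ne]
      simp only [t, Function.update_self, h, extendForm_add]
    · have t : ∀ Θ : StrongDual ℝ (StrongDual ℝ (E j.succ)),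
          (fun i : Fin m => Function.update x j.succ Θ i.succ) =
            Function.update (fun i : Fin m => x i.succ) j Θ := fun Θ =>
        Fin.tail_update_succ x j Θ
      have h0 : ∀ Θ : StrongDual ℝ (StrongDual ℝ (E j.succ)),
          Function.update x j.succ Θ 0 = x 0 := fun Θ =>
        Function.update_of_ne (Fin.succ_ne_zero j).symm _ _
      simp only [t, h0]
      exact ih _ _ _ _ _

theorem extendForm_update_smul {m : ℕ} : ∀ {E : Fin m → Type u} [∀ i, NormedAddCommGroup (E i)]
    [∀ i, NormedSpace ℝ (E i)] (B : ContinuousMultilinearMap ℝ E ℝ)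
    (x : ∀ i, StrongDual ℝ (StrongDual ℝ (E i))) (i : Fin m) (c : ℝ)
    (Φ : StrongDual ℝ (StrongDual ℝ (E i))),
    extendForm B (Function.update x i (c • Φ)) = c * extendForm B (Function.update x i Φ) := by
  induction m with
  | zero => intro E _ _ B x i; exact i.elim0
  | succ m ih =>
    intro E _ _ B x i
    refine Fin.cases ?_ (fun j => ?_) i <;> intro c Φ <;> simp only [extendForm_succ]
    · have h : contract (c • Φ) B = c • contract Φ B := by
        ext v; simp [contract_apply]
      have t : ∀ Θ : StrongDual ℝ (StrongDual ℝ (E 0)),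
          (fun i : Fin m => Function.update x 0 Θ i.succ) = fun i : Fin m => x i.succ := fun Θ => by
        funext i; simp [Function.update_of_ne]
      simp only [t, Function.update_self, h, extendForm_smul]
    · have t : ∀ Θ : StrongDual ℝ (StrongDual ℝ (E j.succ)),
          (fun i : Fin m => Function.update x j.succ Θ i.succ) =
            Function.update (fun i : Fin m => x i.succ) j Θ := fun Θ =>
        Fin.tail_update_succ x j Θ
      have h0 : ∀ Θ : StrongDual ℝ (StrongDual ℝ (E j.succ)),
          Function.update x j.succ Θ 0 = x 0 := fun Θ =>
        Function.update_of_ne (Fin.succ_ne_zero j).symm _ _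
      simp only [t, h0]
      exact ih _ _ _ _ _

/-- The form `B` with its variables listed in the order `ρ 1, …, ρ m`:
`reorder ρ B (x_{ρ 1}, …, x_{ρ m}) = B (x₁, …, xₘ)`. -/
noncomputable def reorder {m : ℕ} {E : Fin m → Type*} [∀ i, NormedAddCommGroup (E i)]
    [∀ i, NormedSpace ℝ (E i)] (ρ : Equiv.Perm (Fin m)) (B : ContinuousMultilinearMap ℝ E ℝ) :
    ContinuousMultilinearMap ℝ (fun i => E (ρ i)) ℝ where
  toMultilinearMap := MultilinearMap.domDomCongrLinearEquiv' ℝ ℝ E ℝ ρ.symm B.toMultilinearMap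
  cont := B.cont.comp (ContinuousLinearEquiv.piCongrLeft ℝ E ρ).continuous

theorem reorder_apply {m : ℕ} {E : Fin m → Type*} [∀ i, NormedAddCommGroup (E i)]
    [∀ i, NormedSpace ℝ (E i)] (ρ : Equiv.Perm (Fin m)) (B : ContinuousMultilinearMap ℝ E ℝ)
    (x : ∀ i, E i) : reorder ρ B (fun i => x (ρ i)) = B x :=
  congrArg B ((Equiv.piCongrLeft' E ρ.symm).symm_apply_apply x)

theorem norm_reorder_le {m : ℕ} {E : Fin m → Type*} [∀ i, NormedAddCommGroup (E i)]
    [∀ i, NormedSpace ℝ (E i)] (ρ : Equiv.Perm (Fin m)) (B : ContinuousMultilinearMap ℝ E ℝ) :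
    ‖reorder ρ B‖ ≤ ‖B‖ := by
  refine ContinuousMultilinearMap.opNorm_le_bound (norm_nonneg _) fun v => ?_
  obtain ⟨x, rfl⟩ := (Equiv.piCongrLeft' E ρ.symm).surjective v
  change ‖reorder ρ B (fun i => x (ρ i))‖ ≤ ‖B‖ * ∏ i, ‖x (ρ i)‖
  rw [reorder_apply, Equiv.prod_comp ρ fun i => ‖x i‖]
  exact B.le_opNorm x

variable {m : ℕ} {E : Fin m → Type u} {F : Type v}
  [∀ i, NormedAddCommGroup (E i)] [∀ i, NormedSpace ℝ (E i)]
  [NormedAddCommGroup F] [NormedSpace ℝ F]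

/-- The value `AB^ρ(A)(x''₁, …, x''ₘ) ∈ F**` of the Aron-Berner extension: its value at `y' ∈ F*`
is obtained by applying `x''_{ρ 1}`, then `x''_{ρ 2}`, …, and finally `x''_{ρ m}` to the variables
`ρ 1, ρ 2, …, ρ m` of the form `y' ∘ A`. -/
noncomputable def extensionVal (ρ : Equiv.Perm (Fin m)) (A : ContinuousMultilinearMap ℝ E F)
    (x : ∀ i, StrongDual ℝ (StrongDual ℝ (E i))) : StrongDual ℝ (StrongDual ℝ F) :=
  LinearMap.mkContinuous
    { toFun := fun y : StrongDual ℝ F =>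
        extendForm (reorder ρ (y.compContinuousMultilinearMap A)) fun i => x (ρ i)
      map_add' := fun y z => by
        rw [← extendForm_add]
        rfl
      map_smul' := fun c y => by
        rw [RingHom.id_apply, smul_eq_mul, ← extendForm_smul]
        rfl }
    ((∏ i, ‖x (ρ i)‖) * ‖A‖) fun y => by
      refine (norm_extendForm_le _ _).trans ?_
      rw [mul_assoc, mul_comm ‖A‖]
      refine mul_le_mul_of_nonneg_left ((norm_reorder_le _ _).trans ?_) (by positivity)
      exact y.norm_compContinuousMultilinearMap_le A

theorem extensionVal_apply (ρ : Equiv.Perm (Fin m)) (A : ContinuousMultilinearMap ℝ E F)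
    (x : ∀ i, StrongDual ℝ (StrongDual ℝ (E i))) (y : StrongDual ℝ F) :
    extensionVal ρ A x y =
      extendForm (reorder ρ (y.compContinuousMultilinearMap A)) fun i => x (ρ i) := rfl

theorem update_comp_perm {W : Fin m → Type*} [DecidableEq (Fin m)] (ρ : Equiv.Perm (Fin m))
    (x : ∀ i, W i) (j : Fin m) (t : W (ρ j)) :
    (fun i => Function.update x (ρ j) t (ρ i)) =
      Function.update (fun i => x (ρ i)) j t := by
  funext i
  rcases eq_or_ne i j with rfl | h
  · simp
  · rw [Function.update_of_ne h, Function.update_of_ne (ρ.injective.ne h)]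

/-- The Aron-Berner extension `AB^ρ(A) : E₁** × ⋯ × Eₘ** → F**` of a continuous `m`-linear
operator `A : E₁ × ⋯ × Eₘ → F` associated to the permutation `ρ`. -/
noncomputable def extension (ρ : Equiv.Perm (Fin m)) (A : ContinuousMultilinearMap ℝ E F) :
    MultilinearMap ℝ (fun i => StrongDual ℝ (StrongDual ℝ (E i)))
      (StrongDual ℝ (StrongDual ℝ F)) where
  toFun := extensionVal ρ A
  map_update_add' {inst} x i Φ Ψ := by
    obtain rfl : inst = instDecidableEqFin m := Subsingleton.elim _ _
    obtain ⟨j, rfl⟩ := ρ.surjective i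
    ext y
    simp only [add_apply, extensionVal_apply, update_comp_perm]
    exact extendForm_update_add _ _ _ _ _
  map_update_smul' {inst} x i c Φ := by
    obtain rfl : inst = instDecidableEqFin m := Subsingleton.elim _ _
    obtain ⟨j, rfl⟩ := ρ.surjective i
    ext y
    simp only [smul_apply, extensionVal_apply, update_comp_perm]
    exact extendForm_update_smul _ _ _ _ _

theorem extension_apply (ρ : Equiv.Perm (Fin m)) (A : ContinuousMultilinearMap ℝ E F)
    (x : ∀ i, StrongDual ℝ (StrongDual ℝ (E i))) (y : StrongDual ℝ F) :
    extension ρ A x y =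
      extendForm (reorder ρ (y.compContinuousMultilinearMap A)) fun i => x (ρ i) := rfl

end AronBerner

/-- `F*` has a Schauder basis, `(e_n)_{n ≥ 1}` or, if `F` is finite-dimensional,
`e_1, …, e_N`, consisting of Riesz homomorphisms `F → ℝ`. -/
def HasRieszHomSchauderBasis (F : Type*) [NormedAddCommGroup F] [NormedSpace ℝ F] [Lattice F] :
    Prop :=
  (∃ b : SchauderBasis ℝ (StrongDual ℝ F), ∀ n, IsRieszHom (b n)) ∨
    ∃ (N : ℕ) (b : Module.Basis (Fin N) ℝ (StrongDual ℝ F)), ∀ n, IsRieszHom (b n)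

/-! ### Riesz homomorphisms in the dual and evaluation at them -/

namespace DualLattice

variable {E : Type*} [NormedAddCommGroup E] [NormedSpace ℝ E]

/-! The identity `|AB(A)(x)| = AB(A)(|x|)` in `F**` only has to be tested on a basis of `F*`, hence
on Riesz homomorphisms `φ`. For such `φ` every functional in `[0, φ]` is a multiple of `φ`, so the
Riesz–Kantorovich supremum for `|Φ| φ` runs over `cφ` with `0 ≤ c ≤ 1` and gives `|Φ| φ = |Φ φ|`
(`abs_apply_eq_of_abs_map`). This reduces the claim to the scalar form `B = φ ∘ A`, which again
commutes with absolute values.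

Such a `B` has rank one: for nonnegative `v`, `w` the sections `B(•, v)` and `B(•, w)` lie below the
Riesz homomorphism `B(•, v + w)`, so they are proportional. Hence a nonzero `B` splits as a Riesz
homomorphism in the first variable times a form `C` of the same kind in the others
(`section₁_eq_smul`). Contracting with `Φ` multiplies `C` by a scalar, and induction on `m`
concludes (`abs_extendForm`).

Commuting with absolute values already implies positivity, which yields regularity and, through
completeness, continuity. -/

theorem exists_eq_smul_of_ker_le {φ ψ : StrongDual ℝ E} (h : ∀ x, φ x = 0 → ψ x = 0) :
    ∃ c : ℝ, ψ = c • φ := by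
  by_cases h0 : ∃ x, φ x ≠ 0
  · obtain ⟨x, hx⟩ := h0
    refine ⟨ψ x / φ x, ?_⟩
    ext y
    have h1 := h (y - (φ y / φ x) • x) (by
      simp only [map_sub, map_smul, smul_eq_mul]
      field_simp
      ring)
    simp only [map_sub, map_smul, smul_eq_mul] at h1
    simp only [smul_apply, smul_eq_mul]
    rw [sub_eq_zero.1 h1]
    ring
  · push Not at h0
    refine ⟨0, ?_⟩
    ext y
    simp [h y (h0 y)]

variable [Lattice E] [IsBanachLattice E]

/-- The order interval below a Riesz homomorphism consists of multiples of it. -/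
theorem exists_eq_smul_of_le {φ ψ : StrongDual ℝ E} (hφ : ∀ x, |φ x| = φ |x|) (h0 : 0 ≤ ψ)
    (h : ψ ≤ φ) : ∃ c : ℝ, ψ = c • φ := by
  -- The kernel of `φ` is closed under `|·|`, so `φ x = 0` squeezes `ψ |x|`, and with it `ψ x`, to
  -- zero.
  refine exists_eq_smul_of_ker_le fun x hx => ?_
  have h1 : φ |x| = 0 := by rw [← hφ, hx, abs_zero]
  have h2 : ψ |x| = 0 :=
    le_antisymm ((h _ (abs_nonneg x)).trans h1.le) (by simpa using h0 _ (abs_nonneg x))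
  have h3 := abs_apply_le ψ x
  rwa [abs_of_nonneg h0, h2, abs_nonpos_iff] at h3

/-- Evaluation at a Riesz homomorphism is a Riesz homomorphism on the bidual. -/
theorem abs_apply_eq_of_abs_map {φ : StrongDual ℝ E} (hφ : ∀ x, |φ x| = φ |x|)
    (Φ : StrongDual ℝ (StrongDual ℝ E)) : |Φ φ| = |Φ| φ := by
  have hφ0 : 0 ≤ φ := fun x hx => by
    have := hφ x
    rw [abs_of_nonneg hx] at this
    simpa [this] using abs_nonneg (φ x)
  apply le_antisymm
  · have := abs_apply_le Φ φ
    rwa [abs_of_nonneg hφ0] at this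
  · have e : |Φ| = -Φ + posPart (Φ - -Φ) := rfl
    -- Since `|Φ| = -Φ + (2Φ)⁺`, the supremum of `2Φ` over `[0, φ]` has to be at most `2 (Φ φ)⁺ = Φ
    -- φ + |Φ φ|`.
    have key : posVal (Φ - -Φ) φ ≤ Φ φ + |Φ φ| := by
      refine posVal_le _ hφ0 fun ψ h0 h => ?_
      obtain ⟨c, rfl⟩ := exists_eq_smul_of_le hφ h0 h
      have hval : (Φ - -Φ) (c • φ) = 2 * (c * Φ φ) := by
        simp only [sub_apply, neg_apply, map_smul, smul_eq_mul]; ring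
      rw [hval]
      -- The bounds `0 ≤ c ≤ 1` can be read off only when `φ` is nonzero.
      by_cases hz : φ = 0
      · simp [hz]
      obtain ⟨x, hx⟩ : ∃ x, φ x ≠ 0 := by
        by_contra! hc
        exact hz (by ext x; simpa using hc x)
      have hpos : 0 < φ |x| := by rw [← hφ]; exact abs_pos.2 hx
      have hc0 : 0 ≤ c := by
        have := h0 _ (abs_nonneg x)
        simp only [zero_apply, smul_apply, smul_eq_mul] at this
        exact nonneg_of_mul_nonneg_left this hpos
      have hc1 : c ≤ 1 := by
        have := h _ (abs_nonneg x)
        simp only [smul_apply, smul_eq_mul] at this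
        exact (mul_le_iff_le_one_left hpos).1 this
      rcases le_total 0 (Φ φ) with hs | hs
      · rw [abs_of_nonneg hs]; nlinarith
      · rw [abs_of_nonpos hs]; nlinarith [mul_nonneg hc0 (neg_nonneg.2 hs)]
    rw [e, add_apply, posPart_apply _ hφ0, neg_apply]
    change -Φ φ + posVal (Φ - -Φ) φ ≤ _
    linarith

end DualLattice

theorem IsRieszHom.abs_map {E : Type*} [NormedAddCommGroup E] [NormedSpace ℝ E] [Lattice E]
    {φ : StrongDual ℝ E} (hφ : IsRieszHom φ) (x : E) : |φ x| = φ |x| := by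
  change φ x ⊔ -φ x = φ (x ⊔ -x)
  rw [hφ, map_neg]

/-! ### Positivity and automatic continuity -/

section Multi

theorem isPositiveMultilinear_of_abs_map {ι : Type*} {E : ι → Type*} {F : Type*}
    [∀ i, AddCommGroup (E i)] [∀ i, Module ℝ (E i)] [∀ i, Lattice (E i)]
    [∀ i, IsOrderedAddMonoid (E i)] [AddCommGroup F] [Module ℝ F] [Lattice F]
    [IsOrderedAddMonoid F] {A : MultilinearMap ℝ E F} (hA : ∀ x, |A x| = A fun i => |x i|) :
    IsPositiveMultilinear A := fun x hx => by
  have h := hA x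
  simp only [abs_of_nonneg (hx _)] at h
  rw [← h]
  exact abs_nonneg _

theorem IsPositiveMultilinear.mono {ι : Type*} [Finite ι] {E : ι → Type*} {F : Type*}
    [∀ i, AddCommGroup (E i)] [∀ i, Module ℝ (E i)] [∀ i, Lattice (E i)]
    [∀ i, IsOrderedAddMonoid (E i)] [AddCommGroup F] [Module ℝ F] [Lattice F]
    [IsOrderedAddMonoid F] {A : MultilinearMap ℝ E F} (hA : IsPositiveMultilinear A)
    {x y : ∀ i, E i} (hx : ∀ i, 0 ≤ x i) (hxy : ∀ i, x i ≤ y i) : A x ≤ A y := by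
  classical
  have := Fintype.ofFinite ι
  have e : y = x + (y - x) := by abel
  rw [e, A.map_add_univ]
  -- Expanding `A (x + (y - x))` gives nonnegative terms, one of which (all entries from `x`) is `A
  -- x`.
  have h := Finset.single_le_sum (f := fun s : Finset ι => A (s.piecewise x (y - x)))
    (fun s _ => hA _ fun i => by
      by_cases hi : i ∈ s
      · simpa [hi] using hx i
      · simpa [hi] using hxy i) (Finset.mem_univ Finset.univ)
  simpa using h

/-- A multilinear operator between Banach lattices that commutes with absolute values is
continuous. -/
theorem continuous_of_abs_map {ι : Type*} [Fintype ι] {E : ι → Type*} {F : Type*}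
    [∀ i, NormedAddCommGroup (E i)] [∀ i, NormedSpace ℝ (E i)] [∀ i, Lattice (E i)]
    [∀ i, IsBanachLattice (E i)] [NormedAddCommGroup F] [NormedSpace ℝ F] [Lattice F]
    [IsBanachLattice F] {A : MultilinearMap ℝ E F} (hA : ∀ x, |A x| = A fun i => |x i|) :
    Continuous A := by
  have hpos := isPositiveMultilinear_of_abs_map hA
  by_contra hc
  have hunb : ∀ C : ℝ, ∃ u : ∀ i, E i, (∀ i, ‖u i‖ ≤ 1) ∧ C < ‖A u‖ := by
    intro C
    by_contra! hC
    refine hc (A.continuous_of_bound C fun x => ?_)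
    by_cases hx : ∃ i, x i = 0
    · obtain ⟨i, hi⟩ := hx
      rw [A.map_coord_zero i hi, Finset.prod_eq_zero (Finset.mem_univ i) (by simp [hi])]
      simp
    push Not at hx
    have hprod : 0 < ∏ i, ‖x i‖ := Finset.prod_pos fun i _ => norm_pos_iff.2 (hx i)
    have h1 := hC (fun i => ‖x i‖⁻¹ • x i) fun i => by
      rw [norm_smul, norm_inv, norm_norm, inv_mul_cancel₀ (norm_ne_zero_iff.2 (hx i))]
    rw [A.map_smul_univ, norm_smul, Finset.prod_inv_distrib, norm_inv,
      Real.norm_of_nonneg hprod.le, inv_mul_le_iff₀ hprod] at h1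
    linarith
  -- The factor `(2 ^ n) ^ card ι` offsets the weight `2⁻ⁿ` that each argument receives in the
  -- series below, leaving a lower bound `n`.
  choose u hu1 hu using fun n : ℕ => hunb (n * (2 ^ n) ^ Fintype.card ι)
  have hsum : ∀ i, Summable fun n => ((1 / 2 : ℝ) ^ n) • |u n i| := fun i => by
    refine Summable.of_norm_bounded summable_geometric_two fun n => ?_
    rw [norm_smul, norm_abs_eq_norm, Real.norm_of_nonneg (by positivity)]
    exact mul_le_of_le_one_right (by positivity) (hu1 n i)
  have hnn : ∀ i n, 0 ≤ ((1 / 2 : ℝ) ^ n) • |u n i| := fun i n =>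
    smul_nonneg (by positivity) (abs_nonneg _)
  -- By positivity the single value of `A` at the sums of the series dominates its value at every
  -- `n`-th term, so its norm would exceed every `n`.
  obtain ⟨n, hn⟩ := exists_nat_gt ‖A fun i => ∑' n, ((1 / 2 : ℝ) ^ n) • |u n i|‖
  have hle : A (fun i => ((1 / 2 : ℝ) ^ n) • |u n i|) ≤
      A fun i => ∑' n, ((1 / 2 : ℝ) ^ n) • |u n i| :=
    hpos.mono (fun i => hnn i n) fun i => (hsum i).le_tsum n fun k _ => hnn i k
  have h0 : 0 ≤ A fun i => ((1 / 2 : ℝ) ^ n) • |u n i| := hpos _ fun i => hnn i n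
  have hnorm := norm_le_norm_of_abs_le_abs (abs_le_abs_of_nonneg h0 hle)
  rw [A.map_smul_univ, ← hA, norm_smul, norm_abs_eq_norm, Finset.prod_const, Finset.card_univ,
    Real.norm_of_nonneg (by positivity), one_div, inv_pow, inv_pow,
    inv_mul_le_iff₀ (by positivity)] at hnorm
  have h2 := (hu n).trans_le hnorm
  rw [mul_comm] at h2
  rw [one_div] at hn
  exact lt_asymm hn (lt_of_mul_lt_mul_left h2 (by positivity))

end Multi

/-! ### Scalar Riesz multimorphisms have rank one -/

namespace AronBerner

section Form

variable {m : ℕ} {E : Fin (m + 1) → Type*} [∀ i, NormedAddCommGroup (E i)]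
  [∀ i, NormedSpace ℝ (E i)] [∀ i, Lattice (E i)]
  {B : ContinuousMultilinearMap ℝ E ℝ}

theorem abs_apply_cons (hB : ∀ x, |B x| = B fun i => |x i|) (t : E 0)
    (w : ∀ i : Fin m, E i.succ) : |B (Fin.cons t w)| = B (Fin.cons |t| fun i => |w i|) := by
  rw [hB]
  congr 1
  funext i
  refine Fin.cases ?_ (fun j => ?_) i <;> simp

theorem abs_section₁ (hB : ∀ x, |B x| = B fun i => |x i|) (t : E 0)
    (w : ∀ i : Fin m, E i.succ) :
    |section₁ B w t| = section₁ B (fun i => |w i|) |t| := by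
  rw [section₁_apply, section₁_apply, abs_apply_cons hB]

variable [∀ i, IsBanachLattice (E i)]

theorem section₁_mono (hB : ∀ x, |B x| = B fun i => |x i|) {v w : ∀ i : Fin m, E i.succ}
    (hv : ∀ i, 0 ≤ v i) (hvw : ∀ i, v i ≤ w i) : section₁ B v ≤ section₁ B w := fun _ ht =>
  (isPositiveMultilinear_of_abs_map (A := B.toMultilinearMap) hB).mono
    (Fin.cases ht hv) (Fin.cases le_rfl hvw)

theorem section₁_nonneg (hB : ∀ x, |B x| = B fun i => |x i|) {v : ∀ i : Fin m, E i.succ}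
    (hv : ∀ i, 0 ≤ v i) : 0 ≤ section₁ B v := fun _ ht =>
  isPositiveMultilinear_of_abs_map (A := B.toMultilinearMap) hB _ (Fin.cases ht hv)

theorem abs_section₁_of_nonneg (hB : ∀ x, |B x| = B fun i => |x i|)
    {v : ∀ i : Fin m, E i.succ} (hv : ∀ i, 0 ≤ v i) (t : E 0) :
    |section₁ B v t| = section₁ B v |t| := by
  rw [abs_section₁ hB]
  simp only [abs_of_nonneg (hv _)]

/-- Both sections lie in the order interval below the section at `v + w`, which is a Riesz
homomorphism, so both are multiples of it. -/
theorem exists_section₁_eq_smul_of_nonneg (hB : ∀ x, |B x| = B fun i => |x i|)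
    {v w : ∀ i : Fin m, E i.succ} (hv : ∀ i, 0 ≤ v i) (hw : ∀ i, 0 ≤ w i)
    (h0 : section₁ B v ≠ 0) : ∃ c : ℝ, section₁ B w = c • section₁ B v := by
  have hu : ∀ i, 0 ≤ v i + w i := fun i => add_nonneg (hv i) (hw i)
  have hφ := abs_section₁_of_nonneg hB hu
  obtain ⟨a, ha⟩ := DualLattice.exists_eq_smul_of_le hφ (section₁_nonneg hB hv)
    (section₁_mono hB hv fun i => le_add_of_nonneg_right (hw i))
  obtain ⟨b, hb⟩ := DualLattice.exists_eq_smul_of_le hφ (section₁_nonneg hB hw)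
    (section₁_mono hB hw fun i => le_add_of_nonneg_left (hv i))
  have ha0 : a ≠ 0 := by
    rintro rfl
    exact h0 (by rw [ha, zero_smul])
  exact ⟨b / a, by rw [ha, hb, smul_smul, div_mul_cancel₀ _ ha0]⟩

/-- All sections of a scalar Riesz multimorphism are multiples of one Riesz homomorphism. -/
theorem section₁_eq_smul (hB : ∀ x, |B x| = B fun i => |x i|) {v₀ : E 0}
    {v : ∀ i : Fin m, E i.succ} (hv : ∀ i, 0 ≤ v i) (h0 : B (Fin.cons v₀ v) ≠ 0)
    (w : ∀ i : Fin m, E i.succ) :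
    section₁ B w = (B (Fin.cons v₀ w) / B (Fin.cons v₀ v)) • section₁ B v := by
  have hne : section₁ B v ≠ 0 := fun h => h0 (by rw [← section₁_apply, h, zero_apply])
  obtain ⟨c, hc⟩ := exists_section₁_eq_smul_of_nonneg hB hv (fun i => abs_nonneg (w i)) hne
  obtain ⟨d, hd⟩ : ∃ d : ℝ, section₁ B w = d • section₁ B v := by
    -- For `w` of arbitrary sign, `|B(t, w)| = B(|t|, |w|) = c B(|t|, v) = c |B(t, v)|`, so the
    -- kernels are nested.
    refine DualLattice.exists_eq_smul_of_ker_le fun t ht => ?_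
    rw [← abs_eq_zero, abs_section₁ hB, hc, smul_apply, ← abs_section₁_of_nonneg hB hv, ht]
    simp
  have h1 : B (Fin.cons v₀ w) = d * B (Fin.cons v₀ v) := by
    rw [← section₁_apply, hd, smul_apply, section₁_apply, smul_eq_mul]
  rw [h1, mul_div_cancel_right₀ _ h0, hd]

end Form

/-- The extension of a scalar Riesz multimorphism commutes with absolute values. -/
theorem abs_extendForm {m : ℕ} : ∀ {E : Fin m → Type u} [∀ i, NormedAddCommGroup (E i)]
    [∀ i, NormedSpace ℝ (E i)] [∀ i, Lattice (E i)] [∀ i, IsBanachLattice (E i)]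
    {B : ContinuousMultilinearMap ℝ E ℝ} (_ : ∀ x, |B x| = B fun i => |x i|)
    (x : ∀ i, StrongDual ℝ (StrongDual ℝ (E i))),
    |extendForm B x| = extendForm B fun i => |x i| := by
  induction m with
  | zero =>
    intro E _ _ _ _ B hB x
    rw [extendForm_zero, extendForm_zero, hB]
    congr 1
    exact Subsingleton.elim _ _
  | succ m ih =>
    intro E _ _ _ _ B hB x
    by_cases hB0 : ∃ z, B z ≠ 0
    swap
    · push Not at hB0
      -- Homogeneity of `extendForm` then makes both sides vanish.
      have h0 : B = (0 : ℝ) • B := by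
        ext z
        simp [hB0 z]
      rw [h0, extendForm_smul, extendForm_smul]
      simp
    obtain ⟨z, hz⟩ := hB0
    -- Absolute values make the base point nonnegative and its value `|B z|` strictly positive.
    set v₀ : E 0 := |z 0| with hv₀
    set v : ∀ i : Fin m, E i.succ := fun i => |z i.succ| with hv
    have hvn : ∀ i, 0 ≤ v i := fun i => abs_nonneg _
    have hzv : B (Fin.cons v₀ v) = |B z| := by
      rw [hv₀, hv, ← abs_apply_cons hB (z 0) fun i => z i.succ]
      exact congrArg (fun y => |B y|) (Fin.cons_self_tail z)
    have hpos : 0 < B (Fin.cons v₀ v) := hzv ▸ abs_pos.2 hz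
    have hC : ∀ w, |B.curryLeft v₀ w| = B.curryLeft v₀ fun i => |w i| := fun w => by
      have := abs_apply_cons hB v₀ w
      rwa [abs_of_nonneg (abs_nonneg (z 0))] at this
    -- This is the rank-one splitting: `Φ` enters only through a scalar, so `x 0` and `|x 0|` lead
    -- to the same form `B(v₀, •)`, to which the induction hypothesis applies.
    have hcontract : ∀ Φ : StrongDual ℝ (StrongDual ℝ (E 0)),
        contract Φ B = (Φ (section₁ B v) / B (Fin.cons v₀ v)) • B.curryLeft v₀ := fun Φ => by
      ext w
      rw [contract_apply, section₁_eq_smul hB hvn hpos.ne' w, map_smul,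
        smul_apply, B.curryLeft_apply, smul_eq_mul, smul_eq_mul]
      ring
    rw [extendForm_succ, extendForm_succ, hcontract, hcontract, extendForm_smul, extendForm_smul,
      abs_mul, ih hC, abs_div, abs_of_pos hpos,
      DualLattice.abs_apply_eq_of_abs_map (abs_section₁_of_nonneg hB hvn)]

theorem abs_reorder {m : ℕ} {E : Fin m → Type*} [∀ i, NormedAddCommGroup (E i)]
    [∀ i, NormedSpace ℝ (E i)] [∀ i, Lattice (E i)] (ρ : Equiv.Perm (Fin m))
    {B : ContinuousMultilinearMap ℝ E ℝ} (hB : ∀ x, |B x| = B fun i => |x i|)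
    (v : ∀ i, E (ρ i)) : |reorder ρ B v| = reorder ρ B fun i => |v i| := by
  -- Every family is of the form `x ∘ ρ`, the shape on which `reorder_apply` computes.
  obtain ⟨x, rfl⟩ := (Equiv.piCongrLeft' E ρ.symm).surjective v
  change |reorder ρ B fun i => x (ρ i)| = reorder ρ B fun i => |x (ρ i)|
  rw [reorder_apply, reorder_apply ρ B fun i => |x i|, hB]

end AronBerner

/-! ### Testing on the basis and conclusion -/

/-- Functionals agreeing on a basis of Riesz homomorphisms are equal. -/
theorem HasRieszHomSchauderBasis.ext {F : Type*} [NormedAddCommGroup F] [NormedSpace ℝ F]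
    [Lattice F] (hF : HasRieszHomSchauderBasis F) {Φ Ψ : StrongDual ℝ (StrongDual ℝ F)}
    (h : ∀ φ : StrongDual ℝ F, IsRieszHom φ → Φ φ = Ψ φ) : Φ = Ψ := by
  rcases hF with ⟨b, hb⟩ | ⟨N, b, hb⟩
  · ext y
    -- The partial sums of the basis expansion converge to `y`, and `Φ`, `Ψ` agree on each of them.
    refine tendsto_nhds_unique ((Φ.continuous.tendsto y).comp (b.tendsto_proj y))
      (((Ψ.continuous.tendsto y).comp (b.tendsto_proj y)).congr fun s => ?_)
    simp only [Function.comp_apply, b.proj_apply, map_sum, map_smul, h _ (hb _)]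
  · exact ContinuousLinearMap.coe_injective (b.ext fun i => h _ (hb i))

/-- A Riesz multimorphism between Banach lattices is automatically continuous, so that its
Aron-Berner extensions, one for each permutation `ρ`, are defined; if `F*` has a Schauder basis of
Riesz homomorphisms, then all of them are Riesz multimorphisms on the product of the biduals. -/
theorem corollary3p6 (F : Type v) [NormedAddCommGroup F] [NormedSpace ℝ F] [Lattice F]
    [IsBanachLattice F] (hF : HasRieszHomSchauderBasis F)
    (m : ℕ) (E : Fin m → Type u) [∀ i, NormedAddCommGroup (E i)] [∀ i, NormedSpace ℝ (E i)]
    [∀ i, Lattice (E i)] [∀ i, IsBanachLattice (E i)]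
    (A : MultilinearMap ℝ E F) (hA : IsRieszMultimorphism A) :
    ∃ hc : Continuous A, ∀ ρ : Equiv.Perm (Fin m),
      IsRieszMultimorphism (E := fun i => StrongDual ℝ (StrongDual ℝ (E i)))
        (F := StrongDual ℝ (StrongDual ℝ F)) (AronBerner.extension ρ ⟨A, hc⟩) := by
  have hc : Continuous A := continuous_of_abs_map hA.abs_map
  refine ⟨hc, fun ρ => ?_⟩
  have habs : ∀ x : ∀ i, StrongDual ℝ (StrongDual ℝ (E i)),
      |AronBerner.extension ρ ⟨A, hc⟩ x| = AronBerner.extension ρ ⟨A, hc⟩ fun i => |x i| := by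
    intro x
    refine hF.ext fun φ hφ => ?_
    -- At the Riesz homomorphism `φ` the absolute value in `F**` becomes that of a real number,
    -- leaving the scalar form `φ ∘ A`.
    rw [← DualLattice.abs_apply_eq_of_abs_map hφ.abs_map, AronBerner.extension_apply,
      AronBerner.extension_apply]
    refine AronBerner.abs_extendForm (AronBerner.abs_reorder ρ fun z => ?_) _
    change |φ (A z)| = φ (A fun i => |z i|)
    rw [hφ.abs_map, hA.abs_map]
  -- The extension is itself positive, so regularity holds with subtrahend `0`.
  exact ⟨⟨_, 0, isPositiveMultilinear_of_abs_map habs, fun _ _ => le_rfl,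
    MultilinearMap.ext fun x => (sub_zero (AronBerner.extension ρ ⟨A, hc⟩ x)).symm⟩, habs⟩
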